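/- Work with point-free (localic) spaces: $[\mathbb T]$ denotes the space (locale) of models of a propositional geometric theory $\mathbb T$, a map of spaces is a morphism of locales, and a point of $[\mathbb T]$ means a generalized point, that is, a model of $\mathbb T$ with truth values in an arbitrary frame. Let $\mathbb Q_{\ge0}$ and $\mathbb Q_{>0}$ be the non-negative and the positive rationals. A non-negative Dedekind real, i.e. a point $x=(L_x,R_x)$ of $[0,\infty)$, is a pair of subsets of $\mathbb Q$, written $q<x$ for $q\in L_x$ and $x<r$ for $r\in R_x$, that are inhabited and rounded, $L_x$ downward closed and $R_x$ upward closed, with $q<x<r\Rightarrow q<r$, with $q<r\Rightarrow(q<x\ \text{or}\ x<r)$, and with $\neg(x<0)$. A non-negative lower real, i.e. a point of $\overrightarrow{[0,\infty]}$, is a rounded downward closed subset of $\mathbb Q$ that contains all negative rationals; a non-negative upper real, i.e. a point of $\overleftarrow{[0,\infty]}$, is a rounded upward closed subset of $\mathbb Q$ that does not contain $0$. For a lower real $x$ and $s\in\mathbb Q_{\ge0}$ write $s<_0x$ for "$s<x$ or $s=0$". Natural number powers of rationals $(s,a)\mapsto s^a$ lift to maps of spaces $$\overrightarrow{[0,\infty]}\times\mathbb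 N\to\overrightarrow{[0,\infty]},\qquad \overleftarrow{[0,\infty]}\times\mathbb N\to\overleftarrow{[0,\infty]},$$ which extend the powers of non-negative rationals and are given by $$q<x^a\iff\exists s\in\mathbb Q_{\ge0}\,(s<_0x\ \text{and}\ q<s^a),$$ $$x^a<r\iff\exists s\in\mathbb Q_{>0}\,(x<s\ \text{and}\ s^a<r)\ \text{ or }\ (a=0\ \text{and}\ 1<r),$$ respectively. These combine to a map of spaces $$[0,\infty)\times\mathbb N\to[0,\infty),\qquad (x,a)\mapsto x^a=(L_x^a,R_x^a).$$ With the product of non-negative Dedekind reals given by $q<xy\iff\exists s,t\in\mathbb Q_{\ge0}\,(s<_0x,\ t<_0y,\ q<st)$ and $xy<r\iff\exists s,t\in\mathbb Q\,(x<s,\ y<t,\ st<r)$, this map satisfies the Basic Equations: for all points $x,y$ of $[0,\infty)$ and $a,b$ of $\mathbb N$, $$x^{a+b}=x^ax^b,\quad x^0=1;\qquad x^{ab}=(x^a)^b,\quad x^1=x;\qquad (xy)^a=x^ay^a,\quad 1^a=1.$$ -/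

import Mathlib

universe u v

namespace PointFree

/-- A propositional geometric theory.  A geometric formula over the propositional symbols `Sym`
is a (possibly infinite) disjunction of finite conjunctions of symbols and is represented by the
set of its disjuncts, each of them a finite set of symbols.  So `{∅}` is truth, `∅` is falsity,
and `{{g, h}, {k}}` is `(g ∧ h) ∨ k`.  An axiom `(φ, ψ)` is the sequent `φ ⇒ ψ`. -/
structure PropTheory where
  /-- the propositional symbols -/
  Sym : Type
  /-- the axioms -/
  Ax : Set (Set (Finset Sym) × Set (Finset Sym))

namespace PropTheory

/-- The truth value, in the frame `A`, of a geometric formula under an interpretation `m` of the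
symbols. -/
def eval {S : Type} {A : Type u} [Order.Frame A] (m : S → A) (φ : Set (Finset S)) : A :=
  ⨆ c ∈ φ, c.inf m

/-- A model of `T` with truth values in the frame `A`, i.e. a model of `T` in any topos whose frame
of subterminal objects is `A`.  For `A = Prop` these are the ordinary models; in general they are
the points of the space `[T]` at stage `A`. -/
@[ext]
structure Model (T : PropTheory) (A : Type u) [Order.Frame A] where
  /-- the interpretation of the symbols -/
  val : T.Sym → A
  /-- the axioms hold -/
  holds : ∀ σ ∈ T.Ax, eval val σ.1 ≤ eval val σ.2

/-- Transport of a model along a frame homomorphism. -/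
def Model.map {T : PropTheory} {A : Type u} {B : Type v} [Order.Frame A] [Order.Frame B]
    (M : T.Model A) (h : FrameHom A B) : T.Model B where
  val g := h (M.val g)
  holds σ hσ := by
    have key : ∀ φ : Set (Finset T.Sym),
        eval (fun g => h (M.val g)) φ = h (eval M.val φ) := by
      intro φ
      simp only [eval, map_iSup₂]
      exact iSup_congr fun c => iSup_congr fun _ => (map_finset_inf h c M.val).symm
    rw [key, key]
    exact OrderHomClass.mono h (M.holds σ hσ)

/-! ### The frame of opens of a theory -/

open scoped Classical in
/-- A set of finite conjunctions that is closed under derivability: with a conjunction it contains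
every stronger one, and it contains `c ∧ e`, for a disjunct `e` of the left side of an axiom
`φ ⇒ ψ`, as soon as it contains `c ∧ d` for all disjuncts `d` of the right side. -/
def IsClosedUnder (T : PropTheory) (U : Set (Finset T.Sym)) : Prop :=
  (∀ c d, c ∈ U → c ⊆ d → d ∈ U) ∧
    ∀ σ ∈ T.Ax, ∀ c, (∀ d ∈ σ.2, c ∪ d ∈ U) → ∀ e ∈ σ.1, c ∪ e ∈ U

/-- The frame of opens of `[T]` (the Lindenbaum algebra of `T`): the class of a geometric formula
modulo provable equivalence is represented by the set of all finite conjunctions of symbols which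
entail it. -/
@[ext]
structure Opens (T : PropTheory) where
  /-- the finite conjunctions of symbols that entail the open -/
  carrier : Set (Finset T.Sym)
  /-- closure under derivability -/
  closed : T.IsClosedUnder carrier

namespace Opens

variable {T : PropTheory}

instance : PartialOrder T.Opens :=
  PartialOrder.lift Opens.carrier fun _ _ => Opens.ext

theorem le_def {U V : T.Opens} : U ≤ V ↔ U.1 ⊆ V.1 := Iff.rfl

theorem isClosedUnder_sInter (s : Set (Set (Finset T.Sym))) (hs : ∀ U ∈ s, T.IsClosedUnder U) :
    T.IsClosedUnder (⋂₀ s) := by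
  refine ⟨fun c d hc hcd U hU => (hs U hU).1 c d (hc U hU) hcd, ?_⟩
  intro σ hσ c h e he U hU
  exact (hs U hU).2 σ hσ c (fun d hd => h d hd U hU) e he

instance : InfSet T.Opens :=
  ⟨fun s => ⟨⋂₀ (Opens.carrier '' s), isClosedUnder_sInter _ (by
    rintro _ ⟨U, _, rfl⟩
    exact U.2)⟩⟩

theorem isGLB_sInf' (s : Set T.Opens) : IsGLB s (sInf s) := by
  constructor
  · intro U hU c hc
    exact hc U.1 ⟨U, hU, rfl⟩
  · rintro V hV c hc _ ⟨U, hU, rfl⟩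
    exact hV hU hc

instance : CompleteLattice T.Opens := completeLatticeOfInf _ isGLB_sInf'

open scoped Classical in
/-- The implication of two opens. -/
def imp (U V : T.Opens) : T.Opens :=
  ⟨{c | ∀ d ∈ U.1, c ∪ d ∈ V.1}, by
    refine ⟨fun c d hc hcd e he => V.2.1 _ _ (hc e he) (Finset.union_subset_union_left hcd), ?_⟩
    intro σ hσ c h e he x hx
    have := V.2.2 σ hσ (c ∪ x) (fun d hd => by
      have := h d hd x hx
      rwa [Finset.union_right_comm] at this) e he
    rwa [Finset.union_right_comm] at this⟩

theorem le_imp_iff (U V W : T.Opens) : W ≤ imp U V ↔ W ⊓ U ≤ V := by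
  classical
  constructor
  · intro h c hc
    have h1 : c ∈ W.1 := (inf_le_left : W ⊓ U ≤ W) hc
    have h2 : c ∈ U.1 := (inf_le_right : W ⊓ U ≤ U) hc
    have := h h1 c h2
    rwa [Finset.union_idempotent] at this
  · intro h c hc d hd
    let X : T.Opens := ⟨W.1 ∩ U.1, by
      have := isClosedUnder_sInter {W.1, U.1} (by
        rintro Y (rfl | rfl)
        exacts [W.2, U.2])
      rwa [Set.sInter_pair] at this⟩
    have hX : X ≤ W ⊓ U := le_inf (fun _ hx => hx.1) (fun _ hx => hx.2)
    exact h (hX ⟨W.2.1 _ _ hc Finset.subset_union_left, U.2.1 _ _ hd Finset.subset_union_right⟩)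

instance : Order.Frame T.Opens := Order.Frame.ofMinimalAxioms
  { inf_sSup_le_iSup_inf := fun a s => by
      rw [inf_comm, ← le_imp_iff]
      refine sSup_le fun b hb => ?_
      rw [le_imp_iff, inf_comm]
      exact le_iSup₂_of_le b hb le_rfl }

/-- The open named by a symbol. -/
def gen (g : T.Sym) : T.Opens := sInf {U | {g} ∈ U.1}

theorem mem_gen (g : T.Sym) : {g} ∈ (gen g).1 := by
  rintro _ ⟨U, hU, rfl⟩
  exact hU

theorem mem_inf_gen (c : Finset T.Sym) : c ∈ (c.inf (gen (T := T))).1 := by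
  rw [Finset.inf_eq_iInf, iInf]
  rintro _ ⟨U, ⟨g, rfl⟩, rfl⟩
  simp only [iInf]
  rintro _ ⟨U, ⟨hg, rfl⟩, rfl⟩
  exact (gen g).2.1 _ _ (mem_gen g) (Finset.singleton_subset_iff.2 hg)

theorem inf_gen_le {c : Finset T.Sym} {U : T.Opens} : c.inf gen ≤ U ↔ c ∈ U.1 := by
  classical
  refine ⟨fun h => h (mem_inf_gen c), ?_⟩
  induction c using Finset.induction_on generalizing U with
  | empty =>
    intro h c _
    exact U.2.1 _ _ h (Finset.empty_subset c)
  | insert g c _ ih =>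
    intro h
    rw [Finset.inf_insert, ← le_imp_iff]
    refine sInf_le ?_
    intro d hd
    let V : T.Opens := ⟨{x | {g} ∪ x ∈ U.1}, by
      refine ⟨fun x y hx hxy => U.2.1 _ _ hx (Finset.union_subset_union_right hxy), ?_⟩
      intro σ hσ x h e he
      have := U.2.2 σ hσ ({g} ∪ x) (fun d hd => by
        rw [Finset.union_assoc]
        exact h d hd) e he
      rwa [Finset.union_assoc] at this⟩
    exact (ih (U := V) (by
      rw [Finset.insert_eq] at h
      exact h)) hd

end Opens

/-- The generic model of `T`, in the frame of opens of `[T]`. -/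
def generic (T : PropTheory) : T.Model T.Opens where
  val := Opens.gen
  holds σ hσ := by
    refine iSup₂_le fun e he => Opens.inf_gen_le.2 ?_
    have := (eval Opens.gen σ.2).2.2 σ hσ ∅ (fun d hd => by
      have : d.inf Opens.gen ≤ eval (Opens.gen (T := T)) σ.2 := le_iSup₂_of_le d hd le_rfl
      simpa using this (Opens.mem_inf_gen d)) e he
    simpa using this

section Lift

variable {T : PropTheory} {A : Type u} [Order.Frame A] (M : T.Model A)

theorem Model.isClosedUnder (b : A) : T.IsClosedUnder {c | c.inf M.val ≤ b} := by
  classical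
  refine ⟨fun c d hc hcd => (Finset.inf_mono hcd).trans hc, ?_⟩
  intro σ hσ c h e he
  have h1 : e.inf M.val ≤ eval M.val σ.2 :=
    (le_iSup₂_of_le (f := fun c (_ : c ∈ σ.1) => c.inf M.val) e he le_rfl).trans (M.holds σ hσ)
  have h2 : eval M.val σ.2 ≤ c.inf M.val ⇨ b := by
    refine iSup₂_le fun d hd => ?_
    rw [le_himp_iff, inf_comm, ← Finset.inf_union]
    exact h d hd
  have h3 := h1.trans h2
  rw [le_himp_iff, inf_comm, ← Finset.inf_union] at h3
  exact h3

/-- The frame homomorphism out of the frame of opens that is induced by a model. -/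
def Model.lift : FrameHom T.Opens A where
  toFun U := eval M.val U.1
  map_inf' U V := by
    classical
    refine le_antisymm (le_inf ?_ ?_) ?_
    · exact biSup_mono fun c hc => (inf_le_left : U ⊓ V ≤ U) hc
    · exact biSup_mono fun c hc => (inf_le_right : U ⊓ V ≤ V) hc
    · simp only [eval, iSup_inf_eq, inf_iSup_eq]
      refine iSup₂_le fun c hc => iSup₂_le fun d hd => ?_
      rw [← Finset.inf_union]
      refine le_iSup₂_of_le (f := fun c (_ : c ∈ (U ⊓ V).1) => c.inf M.val) _ ?_ le_rfl
      refine Opens.inf_gen_le.1 (le_inf (Opens.inf_gen_le.2 ?_) (Opens.inf_gen_le.2 ?_))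
      · exact U.2.1 _ _ hd Finset.subset_union_left
      · exact V.2.1 _ _ hc Finset.subset_union_right
  map_top' := by
    refine top_le_iff.1 (le_iSup₂_of_le (∅ : Finset T.Sym) ?_ (by simp))
    exact Opens.inf_gen_le.1 le_top
  map_sSup' s := by
    refine le_antisymm ?_ (sSup_le ?_)
    · let V : T.Opens := ⟨_, M.isClosedUnder (sSup ((fun U : T.Opens => eval M.val U.1) '' s))⟩
      have hV : sSup s ≤ V := sSup_le fun U hU c hc =>
        (le_iSup₂_of_le (f := fun c (_ : c ∈ U.1) => c.inf M.val) c hc le_rfl).trans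
          (le_sSup ⟨U, hU, rfl⟩)
      exact iSup₂_le fun c hc => hV hc
    · rintro _ ⟨U, hU, rfl⟩
      exact biSup_mono fun c hc => (le_sSup hU : U ≤ sSup s) hc

theorem Model.lift_gen (g : T.Sym) : M.lift (Opens.gen g) = M.val g := by
  refine le_antisymm ?_ ?_
  · have : Opens.gen g ≤ (⟨_, M.isClosedUnder (M.val g)⟩ : T.Opens) :=
      sInf_le (by
        change ({g} : Finset T.Sym).inf M.val ≤ M.val g
        simp)
    exact iSup₂_le fun c hc => this hc
  · exact le_iSup₂_of_le (f := fun c (_ : c ∈ (Opens.gen g).1) => c.inf M.val) {g}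
      (Opens.mem_gen g) (by simp)

theorem Opens.eq_eval (U : T.Opens) : U = eval Opens.gen U.1 :=
  le_antisymm
    (fun c hc => (le_iSup₂_of_le (f := fun c (_ : c ∈ U.1) => c.inf Opens.gen) c hc le_rfl :
      c.inf Opens.gen ≤ eval Opens.gen U.1) (Opens.mem_inf_gen c))
    (iSup₂_le fun _ hc => Opens.inf_gen_le.2 hc)

/-- The universal property of the frame of opens: models of `T` in `A` are the same as frame
homomorphisms to `A`, through the generic model. -/
def modelEquiv (T : PropTheory) (A : Type u) [Order.Frame A] :
    FrameHom T.Opens A ≃ T.Model A where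
  toFun h := T.generic.map h
  invFun M := M.lift
  left_inv h := by
    ext U
    have h1 : (T.generic.map h).lift U = eval (fun g => h (Opens.gen g)) U.1 := rfl
    rw [h1]
    conv_rhs => rw [Opens.eq_eval U]
    simp only [eval, map_iSup₂]
    exact iSup_congr fun c => iSup_congr fun _ => (map_finset_inf h c Opens.gen).symm
  right_inv M := by
    ext g
    exact M.lift_gen g

end Lift

/-- The localic space `[T]`. -/
def space (T : PropTheory) : Locale.{0} := Locale.of T.Opens

/-- The action of a map of spaces `[T] ⟶ [T']` on points at stage `A`. -/
def apply {T T' : PropTheory} {A : Type u} [Order.Frame A] (f : T.space ⟶ T'.space)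
    (M : T.Model A) : T'.Model A :=
  modelEquiv T' A (((modelEquiv T A).symm M).comp f.unop.hom)

/-- The theory `T` extended by additional axioms; its space is a subspace of `[T]`. -/
def extend (T : PropTheory) (E : Set (Set (Finset T.Sym) × Set (Finset T.Sym))) : PropTheory where
  Sym := T.Sym
  Ax := T.Ax ∪ E

/-- The theory of pairs of a model of `T` and a model of `T'`, with space `[T] × [T']`. -/
def prod (T T' : PropTheory) : PropTheory where
  Sym := T.Sym ⊕ T'.Sym
  Ax := {τ | ∃ σ ∈ T.Ax, τ = ((fun c => c.map .inl) '' σ.1, (fun c => c.map .inl) '' σ.2)} ∪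
    {τ | ∃ σ ∈ T'.Ax, τ = ((fun c => c.map .inr) '' σ.1, (fun c => c.map .inr) '' σ.2)}

theorem eval_map {S S' : Type} {A : Type u} [Order.Frame A] (m : S' → A) (i : S ↪ S')
    (φ : Set (Finset S)) : eval m ((fun c => c.map i) '' φ) = eval (fun g => m (i g)) φ := by
  simp only [eval, iSup_image, Finset.inf_map]
  rfl

/-- The points of `[T] × [T']` are the pairs of points. -/
def prodEquiv (T T' : PropTheory) (A : Type u) [Order.Frame A] :
    T.Model A × T'.Model A ≃ (T.prod T').Model A where
  toFun p :=
    { val := Sum.elim p.1.val p.2.val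
      holds := by
        rintro _ (⟨σ, hσ, rfl⟩ | ⟨σ, hσ, rfl⟩)
        · have h1 := eval_map (S' := T.Sym ⊕ T'.Sym) (Sum.elim p.1.val p.2.val) .inl σ.1
          have h2 := eval_map (S' := T.Sym ⊕ T'.Sym) (Sum.elim p.1.val p.2.val) .inl σ.2
          exact h1.trans_le ((p.1.holds σ hσ).trans_eq h2.symm)
        · have h1 := eval_map (S' := T.Sym ⊕ T'.Sym) (Sum.elim p.1.val p.2.val) .inr σ.1
          have h2 := eval_map (S' := T.Sym ⊕ T'.Sym) (Sum.elim p.1.val p.2.val) .inr σ.2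
          exact h1.trans_le ((p.2.holds σ hσ).trans_eq h2.symm) }
  invFun M :=
    ({ val := fun g => M.val (.inl g)
       holds := fun σ hσ => by
         have h1 := eval_map (S' := T.Sym ⊕ T'.Sym) M.val .inl σ.1
         have h2 := eval_map (S' := T.Sym ⊕ T'.Sym) M.val .inl σ.2
         exact h1.symm.trans_le ((M.holds _ (Or.inl ⟨σ, hσ, rfl⟩)).trans_eq h2) },
     { val := fun g => M.val (.inr g)
       holds := fun σ hσ => by
         have h1 := eval_map (S' := T.Sym ⊕ T'.Sym) M.val .inr σ.1
         have h2 := eval_map (S' := T.Sym ⊕ T'.Sym) M.val .inr σ.2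
         exact h1.symm.trans_le ((M.holds _ (Or.inr ⟨σ, hσ, rfl⟩)).trans_eq h2) })
  left_inv _ := rfl
  right_inv M := by
    ext g
    rcases g with g | g <;> rfl

@[simp]
theorem eval_truth {S : Type} {A : Type u} [Order.Frame A] (m : S → A) :
    eval m {∅} = ⊤ := by
  simp [eval]

@[simp]
theorem eval_falsity {S : Type} {A : Type u} [Order.Frame A] (m : S → A) :
    eval m ∅ = ⊥ := by
  simp [eval]

@[simp]
theorem eval_atom {S : Type} {A : Type u} [Order.Frame A] (m : S → A) (g : S) :
    eval m {{g}} = m g := by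
  simp [eval]

theorem eval_exists {S I : Type} {A : Type u} [Order.Frame A] (m : S → A) (P : I → Prop)
    (g : I → S) : eval m {c | ∃ i, P i ∧ c = {g i}} = ⨆ (i) (_ : P i), m (g i) := by
  refine le_antisymm (iSup₂_le ?_) (iSup₂_le fun i hi => ?_)
  · rintro _ ⟨i, hi, rfl⟩
    simpa using le_iSup₂_of_le (f := fun i (_ : P i) => m (g i)) i hi le_rfl
  · exact le_iSup₂_of_le (f := fun c (_ : c ∈ {c | ∃ i, P i ∧ c = {g i}}) => Finset.inf c m)
      {g i} ⟨i, hi, rfl⟩ (by simp)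

end PropTheory

open PropTheory

/-! ### The theories of reals and of natural numbers -/

/-- The symbols of the theory of Dedekind reals: `L q` stands for `q < x`, `R r` for `x < r`. -/
inductive Cut : Type where
  | L (q : ℚ)
  | R (r : ℚ)
  deriving DecidableEq

open Cut in
/-- The axioms of the theory of Dedekind reals. -/
inductive DedekindAx : Set (Set (Finset Cut) × Set (Finset Cut))
  | right_inhabited : DedekindAx ({∅}, {c | ∃ r, True ∧ c = {R r}})
  | upward_closed (r : ℚ) : DedekindAx ({c | ∃ r', r' < r ∧ c = {R r'}}, {{R r}})
  | right_rounded (r : ℚ) : DedekindAx ({{R r}}, {c | ∃ r', r' < r ∧ c = {R r'}})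
  | left_inhabited : DedekindAx ({∅}, {c | ∃ q, True ∧ c = {L q}})
  | downward_closed (q : ℚ) : DedekindAx ({c | ∃ q', q < q' ∧ c = {L q'}}, {{L q}})
  | left_rounded (q : ℚ) : DedekindAx ({{L q}}, {c | ∃ q', q < q' ∧ c = {L q'}})
  | separated (q r : ℚ) (h : ¬ q < r) : DedekindAx ({{L q, R r}}, ∅)
  | located (q r : ℚ) (h : q < r) : DedekindAx ({∅}, {{L q}, {R r}})

/-- The theory of Dedekind reals, with space `ℝ`. -/
def dedekind : PropTheory where
  Sym := Cut
  Ax := DedekindAx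

/-- The theory of the closed subspace `[0, ∞)` of `ℝ`: no Dedekind real `x` with `x < 0`. -/
def nonnegDedekind : PropTheory := dedekind.extend {({{Cut.R 0}}, ∅)}

/-- The axioms of the theory of lower reals; the symbol `q` stands for `q < x`. -/
inductive LowerAx : Set (Set (Finset ℚ) × Set (Finset ℚ))
  | downward_closed (q : ℚ) : LowerAx ({c | ∃ q', q < q' ∧ c = {q'}}, {{q}})
  | rounded (q : ℚ) : LowerAx ({{q}}, {c | ∃ q', q < q' ∧ c = {q'}})

/-- The axioms of the theory of upper reals; the symbol `r` stands for `x < r`. -/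
inductive UpperAx : Set (Set (Finset ℚ) × Set (Finset ℚ))
  | upward_closed (r : ℚ) : UpperAx ({c | ∃ r', r' < r ∧ c = {r'}}, {{r}})
  | rounded (r : ℚ) : UpperAx ({{r}}, {c | ∃ r', r' < r ∧ c = {r'}})

/-- The theory of lower reals, with space `[-∞, ∞]`. -/
def lowerReal : PropTheory where
  Sym := ℚ
  Ax := LowerAx

/-- The theory of upper reals, with space `[-∞, ∞]`. -/
def upperReal : PropTheory where
  Sym := ℚ
  Ax := UpperAx

/-- The theory of non-negative lower reals, with space `[0, ∞]`: negative rationals are below. -/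
def nonnegLower : PropTheory := lowerReal.extend {σ | ∃ q : ℚ, q < 0 ∧ σ = ({∅}, {{q}})}

/-- The theory of non-negative upper reals, with space `[0, ∞]`: `0` is not above. -/
def nonnegUpper : PropTheory := upperReal.extend {({{(0 : ℚ)}}, ∅)}

/-- The axioms of the theory of an element of `ℕ`; the symbol `n` stands for `a = n`. -/
inductive NatAx : Set (Set (Finset ℕ) × Set (Finset ℕ))
  | total : NatAx ({∅}, {c | ∃ n, True ∧ c = {n}})
  | disjoint (m n : ℕ) (h : m ≠ n) : NatAx ({{m, n}}, ∅)

/-- The theory whose space is the discrete space `ℕ`. -/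
def natural : PropTheory where
  Sym := ℕ
  Ax := NatAx

/-! ### The models in a frame, explicitly -/

section Explicit

variable {A : Type u} [Order.Frame A]

theorem nonnegLower_iff (m : ℚ → A) :
    (∀ σ ∈ nonnegLower.Ax, eval m σ.1 ≤ eval m σ.2) ↔
      (∀ q, m q = ⨆ (q') (_ : q < q'), m q') ∧ ∀ q < 0, m q = ⊤ := by
  constructor
  · intro h
    refine ⟨fun q => le_antisymm ?_ ?_, fun q hq => ?_⟩
    · have := h _ (Or.inl (LowerAx.rounded q))
      rwa [eval_exists, eval_atom] at this
    · have := h _ (Or.inl (LowerAx.downward_closed q))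
      rwa [eval_exists, eval_atom] at this
    · have : eval (S := ℚ) m {∅} ≤ eval (S := ℚ) m {{q}} := h _ (Or.inr ⟨q, hq, rfl⟩)
      rwa [eval_truth, eval_atom, top_le_iff] at this
  · rintro ⟨h1, h2⟩ σ (h | ⟨q, hq, rfl⟩)
    · rcases h with q | q
      · rw [eval_exists, eval_atom]
        exact (h1 q).ge
      · rw [eval_exists, eval_atom]
        exact (h1 q).le
    · change eval (S := ℚ) m {∅} ≤ eval (S := ℚ) m {{q}}
      rw [eval_truth, eval_atom, h2 q hq]

theorem nonnegUpper_iff (m : ℚ → A) :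
    (∀ σ ∈ nonnegUpper.Ax, eval m σ.1 ≤ eval m σ.2) ↔
      (∀ r, m r = ⨆ (r') (_ : r' < r), m r') ∧ m 0 = ⊥ := by
  constructor
  · intro h
    refine ⟨fun q => le_antisymm ?_ ?_, ?_⟩
    · have := h _ (Or.inl (UpperAx.rounded q))
      rwa [eval_exists, eval_atom] at this
    · have := h _ (Or.inl (UpperAx.upward_closed q))
      rwa [eval_exists, eval_atom] at this
    · have : eval (S := ℚ) m {{0}} ≤ eval (S := ℚ) m ∅ := h _ (Or.inr rfl)
      rwa [eval_falsity, eval_atom, le_bot_iff] at this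
  · rintro ⟨h1, h2⟩ σ (h | h)
    · rcases h with q | q
      · rw [eval_exists, eval_atom]
        exact (h1 q).ge
      · rw [eval_exists, eval_atom]
        exact (h1 q).le
    · subst h
      change eval (S := ℚ) m {{0}} ≤ eval (S := ℚ) m ∅
      rw [eval_falsity, eval_atom, h2]

theorem nonnegDedekind_iff (m : Cut → A) :
    (∀ σ ∈ nonnegDedekind.Ax, eval m σ.1 ≤ eval m σ.2) ↔
      ((∀ q, m (.L q) = ⨆ (q') (_ : q < q'), m (.L q')) ∧ ∀ q < 0, m (.L q) = ⊤) ∧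
      ((∀ r, m (.R r) = ⨆ (r') (_ : r' < r), m (.R r')) ∧ m (.R 0) = ⊥) ∧
      (⨆ r, m (.R r)) = ⊤ ∧ (∀ q r, ¬ q < r → m (.L q) ⊓ m (.R r) = ⊥) ∧
      ∀ q r, q < r → m (.L q) ⊔ m (.R r) = ⊤ := by
  have hpair : ∀ q r, eval m {{Cut.L q, Cut.R r}} = m (.L q) ⊓ m (.R r) := by
    intro q r
    simp [eval]
  have hor : ∀ q r, eval m {{Cut.L q}, {Cut.R r}} = m (.L q) ⊔ m (.R r) := by
    intro q r
    simp [eval, iSup_or, iSup_sup_eq]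
  constructor
  · intro h
    have hloc : ∀ q r, q < r → m (.L q) ⊔ m (.R r) = ⊤ := by
      intro q r hqr
      have := h _ (Or.inl (DedekindAx.located q r hqr))
      rwa [eval_truth, hor, top_le_iff] at this
    have h0 : m (.R 0) = ⊥ := by
      have : eval (S := Cut) m {{Cut.R 0}} ≤ eval (S := Cut) m ∅ := h _ (Or.inr rfl)
      rwa [eval_falsity, eval_atom, le_bot_iff] at this
    refine ⟨⟨fun q => le_antisymm ?_ ?_, fun q hq => ?_⟩,
      ⟨fun q => le_antisymm ?_ ?_, h0⟩, ?_, fun q r hqr => ?_, hloc⟩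
    · have := h _ (Or.inl (DedekindAx.left_rounded q))
      rwa [eval_exists, eval_atom] at this
    · have := h _ (Or.inl (DedekindAx.downward_closed q))
      rwa [eval_exists, eval_atom] at this
    · have := hloc q 0 hq
      rwa [h0, sup_bot_eq] at this
    · have := h _ (Or.inl (DedekindAx.right_rounded q))
      rwa [eval_exists, eval_atom] at this
    · have := h _ (Or.inl (DedekindAx.upward_closed q))
      rwa [eval_exists, eval_atom] at this
    · have := h _ (Or.inl DedekindAx.right_inhabited)
      rw [eval_exists, eval_truth, top_le_iff] at this
      simpa using this
    · have := h _ (Or.inl (DedekindAx.separated q r hqr))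
      rwa [eval_falsity, hpair, le_bot_iff] at this
  · rintro ⟨⟨h1, h2⟩, ⟨h3, h4⟩, h5, h6, h7⟩ σ (h | h)
    · rcases h with _ | r | r | _ | q | q | ⟨q, r, hqr⟩ | ⟨q, r, hqr⟩
      · rw [eval_exists, eval_truth]
        simpa using h5
      · rw [eval_exists, eval_atom]
        exact (h3 r).ge
      · rw [eval_exists, eval_atom]
        exact (h3 r).le
      · rw [eval_exists, eval_truth, ← h2 (-1) (by norm_num)]
        exact le_iSup₂_of_le (f := fun q (_ : True) => m (.L q)) (-1) trivial le_rfl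
      · rw [eval_exists, eval_atom]
        exact (h1 q).ge
      · rw [eval_exists, eval_atom]
        exact (h1 q).le
      · rw [eval_falsity, hpair, h6 q r hqr]
      · rw [eval_truth, hor, h7 q r hqr]
    · subst h
      change eval (S := Cut) m {{Cut.R 0}} ≤ eval (S := Cut) m ∅
      rw [eval_falsity, eval_atom, h4]

theorem natural_iff (m : ℕ → A) :
    (∀ σ ∈ natural.Ax, eval m σ.1 ≤ eval m σ.2) ↔
      (⨆ n, m n) = ⊤ ∧ ∀ i j, i ≠ j → m i ⊓ m j = ⊥ := by
  have hpair : ∀ i j, eval m {{i, j}} = m i ⊓ m j := by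
    intro i j
    simp [eval]
  constructor
  · intro h
    refine ⟨?_, fun i j hij => ?_⟩
    · have := h _ NatAx.total
      rw [eval_exists, eval_truth, top_le_iff] at this
      simpa using this
    · have := h _ (NatAx.disjoint i j hij)
      rwa [eval_falsity, hpair, le_bot_iff] at this
  · rintro ⟨h1, h2⟩ σ (_ | ⟨i, j, hij⟩)
    · rw [eval_exists, eval_truth]
      simpa using h1
    · rw [eval_falsity, hpair, h2 i j hij]

/-- The truth value of `q < x` for a non-negative lower real `x`. -/
def below (x : nonnegLower.Model A) (q : ℚ) : A := x.val q

/-- The truth value of `x < r` for a non-negative upper real `x`. -/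
def above (x : nonnegUpper.Model A) (r : ℚ) : A := x.val r

/-- The truth value of `a = n` for a point `a` of `ℕ`. -/
def isNat (a : natural.Model A) (n : ℕ) : A := a.val n

theorem below_spec (x : nonnegLower.Model A) :
    (∀ q, below x q = ⨆ (q') (_ : q < q'), below x q') ∧ ∀ q < 0, below x q = ⊤ :=
  (nonnegLower_iff _).1 x.holds

theorem above_spec (x : nonnegUpper.Model A) :
    (∀ r, above x r = ⨆ (r') (_ : r' < r), above x r') ∧ above x 0 = ⊥ :=
  (nonnegUpper_iff _).1 x.holds

theorem isNat_spec (a : natural.Model A) :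
    (⨆ n, isNat a n) = ⊤ ∧ ∀ i j, i ≠ j → isNat a i ⊓ isNat a j = ⊥ :=
  (natural_iff _).1 a.holds

theorem below_anti (x : nonnegLower.Model A) {q q' : ℚ} (h : q ≤ q') :
    below x q' ≤ below x q := by
  rcases h.eq_or_lt with rfl | h
  · exact le_rfl
  · rw [(below_spec x).1 q]
    exact le_iSup₂_of_le (f := fun q' (_ : q < q') => below x q') q' h le_rfl

theorem above_mono (x : nonnegUpper.Model A) {r r' : ℚ} (h : r ≤ r') :
    above x r ≤ above x r' := by
  rcases h.eq_or_lt with rfl | h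
  · exact le_rfl
  · rw [(above_spec x).1 r']
    exact le_iSup₂_of_le (f := fun r (_ : r < r') => above x r) r h le_rfl

theorem above_nonpos (x : nonnegUpper.Model A) {r : ℚ} (h : r ≤ 0) : above x r = ⊥ :=
  le_bot_iff.1 ((above_mono x h).trans_eq (above_spec x).2)

/-- The left section `L_x` of a non-negative Dedekind real `x`. -/
def leftSection (x : nonnegDedekind.Model A) : nonnegLower.Model A where
  val (q : ℚ) := x.val (.L q)
  holds := (nonnegLower_iff _).2 ((nonnegDedekind_iff x.val).1 x.holds).1

/-- The right section `R_x` of a non-negative Dedekind real `x`. -/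
def rightSection (x : nonnegDedekind.Model A) : nonnegUpper.Model A where
  val (r : ℚ) := x.val (.R r)
  holds := (nonnegUpper_iff _).2 ((nonnegDedekind_iff x.val).1 x.holds).2.1

theorem sections_spec (x : nonnegDedekind.Model A) :
    (⨆ r, above (rightSection x) r) = ⊤ ∧
      (∀ q r, ¬ q < r → below (leftSection x) q ⊓ above (rightSection x) r = ⊥) ∧
      ∀ q r, q < r → below (leftSection x) q ⊔ above (rightSection x) r = ⊤ :=
  ((nonnegDedekind_iff x.val).1 x.holds).2.2

/-- The non-negative Dedekind real `(l, u)` with given left section `l` and right section `u`. -/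
def ofSections (l : nonnegLower.Model A) (u : nonnegUpper.Model A)
    (inhabited : (⨆ r, above u r) = ⊤)
    (separated : ∀ q r, ¬ q < r → below l q ⊓ above u r = ⊥)
    (located : ∀ q r, q < r → below l q ⊔ above u r = ⊤) : nonnegDedekind.Model A where
  val
    | .L q => below l q
    | .R r => above u r
  holds := (nonnegDedekind_iff _).2 ⟨below_spec l, above_spec u, inhabited, separated, located⟩

/-! ### Rationals as reals -/

theorem lower_rounded {I : Type} (P : ℚ → I → Prop) (g : I → A)
    (hP : ∀ q i, P q i ↔ ∃ q', q < q' ∧ P q' i) (q : ℚ) :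
    (⨆ (i) (_ : P q i), g i) = ⨆ (q') (_ : q < q'), ⨆ (i) (_ : P q' i), g i := by
  refine le_antisymm (iSup₂_le fun i hi => ?_) (iSup₂_le fun q' hq => iSup₂_le fun i hi => ?_)
  · obtain ⟨q', hq, hi⟩ := (hP q i).1 hi
    exact le_iSup₂_of_le q' hq (le_iSup₂_of_le (f := fun i (_ : P q' i) => g i) i hi le_rfl)
  · exact le_iSup₂_of_le (f := fun i (_ : P q i) => g i) i ((hP q i).2 ⟨q', hq, hi⟩) le_rfl

theorem upper_rounded {I : Type} (P : ℚ → I → Prop) (g : I → A)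
    (hP : ∀ r i, P r i ↔ ∃ r', r' < r ∧ P r' i) (r : ℚ) :
    (⨆ (i) (_ : P r i), g i) = ⨆ (r') (_ : r' < r), ⨆ (i) (_ : P r' i), g i := by
  refine le_antisymm (iSup₂_le fun i hi => ?_) (iSup₂_le fun q' hq => iSup₂_le fun i hi => ?_)
  · obtain ⟨q', hq, hi⟩ := (hP r i).1 hi
    exact le_iSup₂_of_le q' hq (le_iSup₂_of_le (f := fun i (_ : P q' i) => g i) i hi le_rfl)
  · exact le_iSup₂_of_le (f := fun i (_ : P r i) => g i) i ((hP r i).2 ⟨q', hq, hi⟩) le_rfl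

theorem lt_iff_between (q t : ℚ) : q < t ↔ ∃ q', q < q' ∧ q' < t :=
  ⟨exists_between, fun ⟨_, h, h'⟩ => h.trans h'⟩

theorem gt_iff_between (q t : ℚ) : t < q ↔ ∃ q', q' < q ∧ t < q' :=
  ⟨fun h => let ⟨c, h1, h2⟩ := exists_between h; ⟨c, h2, h1⟩, fun ⟨_, h, h'⟩ => h'.trans h⟩

variable (A) in
/-- The rational `s ≥ 0` as a lower real. -/
def ratLower (s : ℚ≥0) : nonnegLower.Model A where
  val (q : ℚ) := ⨆ _ : q < s, ⊤
  holds := (nonnegLower_iff _).2 ⟨fun q => by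
      simpa using lower_rounded (I := Unit) (fun q _ => q < s) (fun _ => (⊤ : A))
        (fun q _ => lt_iff_between q s) q,
    fun q hq => by
      have : q < (s : ℚ) := hq.trans_le s.2
      exact le_antisymm le_top (le_iSup_of_le this le_rfl)⟩

variable (A) in
/-- The rational `s ≥ 0` as an upper real. -/
def ratUpper (s : ℚ≥0) : nonnegUpper.Model A where
  val (r : ℚ) := ⨆ _ : s < r, ⊤
  holds := (nonnegUpper_iff _).2 ⟨fun q => by
      simpa using upper_rounded (I := Unit) (fun q _ => s < q) (fun _ => (⊤ : A))
        (fun q _ => gt_iff_between q s) q,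
    by simp⟩

variable (A) in
/-- The rational `s ≥ 0` as a Dedekind real. -/
def ratDedekind (s : ℚ≥0) : nonnegDedekind.Model A :=
  ofSections (ratLower A s) (ratUpper A s)
    (top_le_iff.1 (le_iSup_of_le (s + 1 : ℚ) (le_iSup_of_le (lt_add_one (s : ℚ)) le_rfl)))
    (fun q r h => by
      rw [← le_bot_iff]
      simp only [below, above, ratLower, ratUpper, iSup_inf_eq, inf_iSup_eq]
      exact iSup₂_le fun h1 h2 => absurd (h2.trans h1) h)
    (fun q r h => by
      rcases lt_or_ge q (s : ℚ) with h1 | h1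
      · simp [below, ratLower, h1]
      · simp [above, ratUpper, h1.trans_lt h])

/-! ### Multiplication of non-negative reals -/

/-- The ideal of non-negative rationals that corresponds to a lower real `x`: the truth value of
`s < x`, where the order is modified so that `0 < 0` is allowed, i.e. `0` always belongs. -/
def ideal (x : nonnegLower.Model A) (s : ℚ≥0) : A := below x s ⊔ ⨆ _ : s = 0, ⊤

/-- `q < x * y` iff `q < s * t` for some `s < x` and `t < y`, with `s, t ≥ 0` and the order
between non-negative rationals and lower reals modified so that `0 < 0`. -/
def lowerMul (x y : nonnegLower.Model A) : nonnegLower.Model A where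
  val (q : ℚ) := ⨆ (p : ℚ≥0 × ℚ≥0) (_ : q < p.1 * p.2), ideal x p.1 ⊓ ideal y p.2
  holds := (nonnegLower_iff _).2
    ⟨lower_rounded _ _ fun q p => lt_iff_between q _,
    fun q hq => top_le_iff.1 (le_iSup₂_of_le (0, 0) (by simpa using hq) (by simp [ideal]))⟩

/-- `x * y < r` iff `s * t < r` for some `s > x` and `t > y`. -/
def upperMul (x y : nonnegUpper.Model A) : nonnegUpper.Model A where
  val (r : ℚ) := ⨆ (p : ℚ × ℚ) (_ : p.1 * p.2 < r), above x p.1 ⊓ above y p.2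
  holds := (nonnegUpper_iff _).2
    ⟨upper_rounded _ _ fun q p => gt_iff_between q _,
    le_bot_iff.1 (iSup₂_le fun p hp => by
      rcases le_or_gt p.1 0 with h | h
      · simp [above_nonpos x h]
      · simp [above_nonpos y (nonpos_of_mul_nonpos_right hp.le h)])⟩

theorem ideal_inf_above (x : nonnegDedekind.Model A) (s : ℚ≥0) (r : ℚ) (h : ¬ (s : ℚ) < r) :
    ideal (leftSection x) s ⊓ above (rightSection x) r = ⊥ := by
  rw [ideal, inf_sup_right, (sections_spec x).2.1 _ _ h, bot_sup_eq]
  by_cases hs : s = 0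
  · subst hs
    rw [above_nonpos _ (by simpa using h), inf_bot_eq]
  · simp [hs]

theorem approx (x : nonnegDedekind.Model A) (δ : ℚ) (hδ : 0 < δ) :
    (⨆ s : ℚ≥0, ideal (leftSection x) s ⊓ above (rightSection x) (s + δ)) = ⊤ := by
  set Z := ⨆ s : ℚ≥0, ideal (leftSection x) s ⊓ above (rightSection x) (s + δ) with hZ
  have step : ∀ n : ℕ, above (rightSection x) (n * (δ / 2)) ≤ Z := by
    intro n
    induction n with
    | zero => simp [above_nonpos]
    | succ n ih =>
      rcases n with _ | n
      · refine le_iSup_of_le 0 (le_inf (by simp [ideal]) (above_mono _ ?_))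
        push_cast
        linarith
      · have h1 := (sections_spec x).2.2 (n * (δ / 2)) ((n + 1 : ℕ) * (δ / 2)) (by
          push_cast
          nlinarith)
        have h2 : ⊤ ≤ below (leftSection x) (n * (δ / 2)) ⊔ Z := by
          rw [← h1]
          exact sup_le_sup_left ih _
        have hn : (0 : ℚ) ≤ n * (δ / 2) := by positivity
        calc above (rightSection x) ((n + 1 + 1 : ℕ) * (δ / 2))
            ≤ (below (leftSection x) (n * (δ / 2)) ⊔ Z) ⊓
                above (rightSection x) ((n + 1 + 1 : ℕ) * (δ / 2)) := le_inf (le_top.trans h2) le_rfl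
          _ ≤ Z := by
            rw [inf_sup_right]
            refine sup_le ?_ inf_le_left
            refine le_iSup_of_le ⟨n * (δ / 2), hn⟩ (inf_le_inf ?_ (above_mono _ ?_))
            · exact le_sup_left
            · change _ ≤ (n * (δ / 2) : ℚ) + δ
              push_cast
              linarith
  rw [← top_le_iff, ← (sections_spec x).1]
  refine iSup_le fun r => ?_
  obtain ⟨n, hn⟩ := exists_nat_ge (r / (δ / 2))
  refine (above_mono _ ?_).trans (step n)
  rwa [div_le_iff₀ (by positivity)] at hn

/-- Multiplication of non-negative Dedekind reals. -/
def mul (x y : nonnegDedekind.Model A) : nonnegDedekind.Model A :=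
  ofSections (lowerMul (leftSection x) (leftSection y))
    (upperMul (rightSection x) (rightSection y))
    (by
      have h : (⨆ r, above (rightSection x) r) ⊓ (⨆ r, above (rightSection y) r) = ⊤ := by
        rw [(sections_spec x).1, (sections_spec y).1, inf_top_eq]
      rw [← top_le_iff, ← h, iSup_inf_iSup]
      refine iSup_le fun p => le_iSup_of_le (p.1 * p.2 + 1) ?_
      exact le_iSup₂_of_le (f := fun (p' : ℚ × ℚ) (_ : p'.1 * p'.2 < p.1 * p.2 + 1) =>
        above (rightSection x) p'.1 ⊓ above (rightSection y) p'.2) p (lt_add_one _) le_rfl)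
    (fun q r hqr => by
      rw [← le_bot_iff]
      simp only [below, above, lowerMul, upperMul, iSup_inf_eq, inf_iSup_eq]
      refine iSup₂_le fun p hp => iSup₂_le fun p' hp' => ?_
      by_cases h1 : (p'.1 : ℚ) < p.1
      · by_cases h2 : (p'.2 : ℚ) < p.2
        · refine absurd ?_ hqr
          have := mul_le_mul h1.le h2.le p'.2.2 (p'.1.2.trans h1.le)
          exact hp'.trans_le (this.trans hp.le)
        · rw [← ideal_inf_above y p'.2 p.2 h2]
          exact inf_le_inf inf_le_right inf_le_right
      · rw [← ideal_inf_above x p'.1 p.1 h1]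
        exact inf_le_inf inf_le_left inf_le_left)
    (fun q r hqr => by
      set Z := below (lowerMul (leftSection x) (leftSection y)) q ⊔
        above (upperMul (rightSection x) (rightSection y)) r with hZ
      have h : (⨆ r, above (rightSection x) r) ⊓ (⨆ r, above (rightSection y) r) = ⊤ := by
        rw [(sections_spec x).1, (sections_spec y).1, inf_top_eq]
      rw [← top_le_iff, ← h, iSup_inf_iSup]
      refine iSup_le fun ⟨B, C⟩ => ?_
      dsimp only
      rcases le_or_gt B 0 with hB | hB
      · simp [above_nonpos _ hB]
      rcases le_or_gt C 0 with hC | hC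
      · simp [above_nonpos _ hC]
      have hδ0 : 0 < (r - q) / (B + C + 1) := div_pos (by linarith) (by linarith)
      obtain ⟨δ, hδ, hδ1, hδ2⟩ : ∃ δ : ℚ, 0 < δ ∧ δ ≤ 1 ∧ δ * (B + C + 1) ≤ r - q :=
        ⟨min 1 ((r - q) / (B + C + 1)), lt_min one_pos hδ0, min_le_left _ _,
          (le_div_iff₀ (by linarith)).1 (min_le_right _ _)⟩
      have h3 := congrArg₂ (· ⊓ ·) (approx x δ hδ) (approx y δ hδ)
      simp only [iSup_inf_iSup, inf_top_eq] at h3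
      rw [← inf_top_eq (above (rightSection x) B ⊓ above (rightSection y) C), ← h3, inf_iSup_eq]
      refine iSup_le fun ⟨s, t⟩ => ?_
      dsimp only
      by_cases hs : (s : ℚ) < B
      swap
      · refine le_trans ?_ bot_le
        rw [← ideal_inf_above x s B hs]
        exact le_inf (inf_le_right.trans (inf_le_left.trans inf_le_left))
          (inf_le_left.trans inf_le_left)
      by_cases ht : (t : ℚ) < C
      swap
      · refine le_trans ?_ bot_le
        rw [← ideal_inf_above y t C ht]
        exact le_inf (inf_le_right.trans (inf_le_right.trans inf_le_left))
          (inf_le_left.trans inf_le_right)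
      refine inf_le_right.trans ?_
      by_cases hq : q < (s : ℚ) * t
      · refine le_trans ?_ le_sup_left
        refine (inf_le_inf inf_le_left inf_le_left).trans ?_
        exact le_iSup₂_of_le (f := fun (p : ℚ≥0 × ℚ≥0) (_ : q < p.1 * p.2) =>
          ideal (leftSection x) p.1 ⊓ ideal (leftSection y) p.2) (s, t) hq le_rfl
      · refine le_trans ?_ le_sup_right
        refine (inf_le_inf inf_le_right inf_le_right).trans ?_
        refine le_iSup₂_of_le (f := fun (p : ℚ × ℚ) (_ : p.1 * p.2 < r) =>
          above (rightSection x) p.1 ⊓ above (rightSection y) p.2) (s + δ, t + δ) ?_ le_rfl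
        have : δ * (s + t + δ) < δ * (B + C + 1) :=
          mul_lt_mul_of_pos_left (by linarith) hδ
        dsimp only
        nlinarith)

/-! ### Natural numbers -/

open scoped Classical in
variable (A) in
/-- The standard natural number `n` as a point of `ℕ`. -/
def nat (n : ℕ) : natural.Model A where
  val (k : ℕ) := if k = n then ⊤ else ⊥
  holds := (natural_iff _).2 ⟨top_le_iff.1 (le_iSup_of_le n (by simp)), fun i j h => by
    by_cases hi : i = n
    · have : j ≠ n := fun hj => h (hi.trans hj.symm)
      simp [this]
    · simp [hi]⟩

/-- The extension of a binary operation on `ℕ` to points of `ℕ`: `f a b = n` iff `a = i` and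
`b = j` for some `i`, `j` with `f i j = n`. -/
def natOp (f : ℕ → ℕ → ℕ) (a b : natural.Model A) : natural.Model A where
  val (n : ℕ) := ⨆ (p : ℕ × ℕ) (_ : f p.1 p.2 = n), isNat a p.1 ⊓ isNat b p.2
  holds := (natural_iff _).2 ⟨by
      have : (⨆ n, isNat a n) ⊓ (⨆ n, isNat b n) = ⊤ := by
        rw [(isNat_spec a).1, (isNat_spec b).1, inf_top_eq]
      rw [← top_le_iff, ← this, iSup_inf_iSup]
      exact iSup_le fun p => le_iSup_of_le (f p.1 p.2)
        (le_iSup₂_of_le (f := fun (p' : ℕ × ℕ) (_ : f p'.1 p'.2 = f p.1 p.2) =>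
          isNat a p'.1 ⊓ isNat b p'.2) p rfl le_rfl),
    fun i j hij => by
      rw [← le_bot_iff]
      simp only [iSup_inf_eq, inf_iSup_eq]
      refine iSup₂_le fun p hp => iSup₂_le fun p' hp' => ?_
      by_cases h1 : p.1 = p'.1
      · by_cases h2 : p.2 = p'.2
        · exact absurd (by rw [← hp, ← hp', h1, h2]) hij
        · have := (isNat_spec b).2 _ _ h2
          rw [← this]
          exact (inf_comm _ _).le.trans (inf_le_inf inf_le_right inf_le_right)
      · have := (isNat_spec a).2 _ _ h1
        rw [← this]
        exact (inf_comm _ _).le.trans (inf_le_inf inf_le_left inf_le_left)⟩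

/-- Addition of points of `ℕ`. -/
def natAdd (a b : natural.Model A) : natural.Model A := natOp (· + ·) a b

/-- Multiplication of points of `ℕ`. -/
def natMul (a b : natural.Model A) : natural.Model A := natOp (· * ·) a b

/-! ### Natural number powers of one-sided reals -/

/-- The map `(x, a) ↦ x ^ a` on non-negative lower reals: the lift of the map that sends the
rational `s ≥ 0` to the lower real `s ^ a`.  So `x ^ a` is the directed join of the lower reals
`s ^ a` for `s` in the ideal of `x`. -/
def lowerPow (x : nonnegLower.Model A) (a : natural.Model A) : nonnegLower.Model A where
  val (q : ℚ) := ⨆ (p : ℕ × ℚ≥0) (_ : q < (p.2 : ℚ) ^ p.1), isNat a p.1 ⊓ ideal x p.2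
  holds := (nonnegLower_iff _).2
    ⟨lower_rounded _ _ fun q p => lt_iff_between q _,
    fun q hq => by
      rw [← top_le_iff, ← (isNat_spec a).1]
      refine iSup_le fun n => le_iSup₂_of_le (n, 0) ?_ ?_
      · exact hq.trans_le (by positivity)
      · simp [ideal]⟩

/-- The map `(x, a) ↦ x ^ a` on non-negative upper reals: the lift of the map that sends
`s ∈ Q₊ ∪ {∞}` to the upper real `s ^ a`.  So `x ^ a` is the join, in the order opposite to the
numerical one, of the upper reals `s ^ a` for `s > x`, where `∞ > x` holds for all `x`.  As
`∞ ^ n = ∞` for `n > 0`, `s = ∞` contributes only `∞ ^ 0 = 1`. -/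
def upperPow (x : nonnegUpper.Model A) (a : natural.Model A) : nonnegUpper.Model A where
  val (r : ℚ) := (⨆ (p : ℕ × ℚ) (_ : 0 < p.2 ∧ p.2 ^ p.1 < r), isNat a p.1 ⊓ above x p.2) ⊔
    ⨆ (_ : 1 < r), isNat a 0
  holds := (nonnegUpper_iff _).2
    ⟨fun r => by
      have h1 := upper_rounded (fun r (p : ℕ × ℚ) => 0 < p.2 ∧ p.2 ^ p.1 < r)
        (fun p => isNat a p.1 ⊓ above x p.2) (fun r p => by
          rw [gt_iff_between r (p.2 ^ p.1)]
          tauto) r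
      have h2 := upper_rounded (I := Unit) (fun r _ => 1 < r) (fun _ => isNat a 0)
        (fun r _ => gt_iff_between r 1) r
      simp only [iSup_unique] at h2
      rw [h1, h2]
      simp only [iSup_sup_eq],
    le_bot_iff.1 (sup_le (iSup₂_le fun p hp => absurd hp.2 (by
      have := hp.1
      push Not
      positivity)) (iSup_le fun h => absurd h (by norm_num)))⟩

end Explicit

/-- The value of a map of spaces `[T] × [T'] ⟶ [T'']` at a pair of points at stage `A`. -/
def apply₂ {T T' T'' : PropTheory} {A : Type u} [Order.Frame A]
    (f : (T.prod T').space ⟶ T''.space) (M : T.Model A) (N : T'.Model A) : T''.Model A :=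
  apply f (prodEquiv T T' A (M, N))

end PointFree

/-! A map of spaces is the same thing as a construction on generalized points that commutes with
frame homomorphisms: it is determined by its value at the generic point. The formulas for `lowerPow`
and `upperPow` use only joins and finite meets, so they are natural in this sense. This yields the
two one-sided maps, and the Dedekind one as soon as the two sections of a power are known to form a
cut.

That they do is the content of `dedekindPow`. Separatedness is monotonicity of powers. Locatedness
combines `approx`, which traps `x` between `s` and `s + δ`, with `exists_pow_add_lt`, which chooses
`δ` uniformly for the bases `s` in a bounded interval.

The Basic Equations are proved for lower reals only. By locatedness a Dedekind real is determined by
its left section (`leftSection_injective`), so nothing has to be checked for upper reals. A lower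
real is handled through a presentation as a join of rationals `v i` weighted by truth values `g i`
(`Presents`). Products and powers of presented reals are presented by the products and powers of the
rationals (`Presents.mul`, `Presents.pow`), and two presentations agree if each index of one is
covered by indices of the other with at least as large a rational (`Presents.eq_of_forall`). Each
equation thereby reduces to the corresponding law for powers of rationals, together with
directedness of the ideal of `x` or disjointness of the truth values of `a = n`. -/

namespace PointFree

open PropTheory

/-! ### Maps of spaces from natural constructions on points -/

namespace PropTheory

variable {T T' T'' : PropTheory} {A : Type u} {B : Type v} [Order.Frame A] [Order.Frame B]

/-- The map of spaces `[T] ⟶ [T']` that is given by a model of `T'` in the opens of `[T]`. -/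
def ofModel (N : T'.Model T.Opens) : T.space ⟶ T'.space :=
  (Frm.ofHom N.lift).op

theorem apply_ofModel (N : T'.Model T.Opens) (M : T.Model A) :
    apply (ofModel N) M = N.map M.lift := by
  ext g
  exact congrArg M.lift (N.lift_gen g)

theorem generic_map_lift (M : T.Model A) : T.generic.map M.lift = M :=
  (modelEquiv T A).right_inv M

/-- A construction on pairs of points which commutes with frame homomorphisms is a map of
spaces. -/
theorem exists_apply₂_eq
    (F : ∀ {C : Type u} [Order.Frame C], T.Model C → T'.Model C → T''.Model C)
    (F₀ : T.Model (T.prod T').Opens → T'.Model (T.prod T').Opens → T''.Model (T.prod T').Opens)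
    (hF : ∀ {C : Type u} [Order.Frame C] (h : FrameHom (T.prod T').Opens C) M N,
      (F₀ M N).map h = F (M.map h) (N.map h)) :
    ∃ f : (T.prod T').space ⟶ T''.space, ∀ (C : Type u) [Order.Frame C] (M : T.Model C)
      (N : T'.Model C), apply₂ f M N = F M N := by
  -- The generic pair lives in a frame in `Type`, whereas `F` acts on frames in `Type u`; hence the
  -- separate `F₀`, the same construction at the stage of the generic pair.
  let p := (prodEquiv T T' _).symm (T.prod T').generic
  refine ⟨ofModel (F₀ p.1 p.2), fun C _ M N => ?_⟩
  -- Every pair is the image of the generic pair under its classifying homomorphism, so naturality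
  -- carries the generic value to the value at the pair.
  have h := generic_map_lift (prodEquiv T T' C (M, N))
  rw [apply₂, apply_ofModel, hF]
  congr 1
  · exact Model.ext (funext fun g => congrFun (congrArg Model.val h) (Sum.inl g))
  · exact Model.ext (funext fun g => congrFun (congrArg Model.val h) (Sum.inr g))

end PropTheory

variable {A : Type u} {B : Type v} [Order.Frame A] [Order.Frame B]

/-! ### Naturality of powers -/

/-- Naturality holds because the formula is geometric: frame homomorphisms preserve arbitrary joins
and finite meets. -/
theorem ideal_map (h : FrameHom A B) (x : nonnegLower.Model A) (s : ℚ≥0) :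
    ideal (x.map h) s = h (ideal x s) := by
  simp only [ideal, map_sup, map_iSup, map_top]
  rfl

theorem lowerPow_map (h : FrameHom A B) (x : nonnegLower.Model A) (a : natural.Model A) :
    (lowerPow x a).map h = lowerPow (x.map h) (a.map h) := by
  refine Model.ext (funext fun (q : ℚ) => ?_)
  change h (⨆ (p : ℕ × ℚ≥0) (_ : q < (p.2 : ℚ) ^ p.1), isNat a p.1 ⊓ ideal x p.2) =
    ⨆ (p : ℕ × ℚ≥0) (_ : q < (p.2 : ℚ) ^ p.1), h (isNat a p.1) ⊓ ideal (x.map h) p.2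
  simp only [ideal_map, map_iSup, map_inf]

theorem upperPow_map (h : FrameHom A B) (x : nonnegUpper.Model A) (a : natural.Model A) :
    (upperPow x a).map h = upperPow (x.map h) (a.map h) := by
  refine Model.ext (funext fun (r : ℚ) => ?_)
  change h ((⨆ (p : ℕ × ℚ) (_ : 0 < p.2 ∧ p.2 ^ p.1 < r), isNat a p.1 ⊓ above x p.2) ⊔
      ⨆ (_ : 1 < r), isNat a 0) =
    (⨆ (p : ℕ × ℚ) (_ : 0 < p.2 ∧ p.2 ^ p.1 < r), h (isNat a p.1) ⊓ h (above x p.2)) ⊔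
      ⨆ (_ : 1 < r), h (isNat a 0)
  simp only [map_sup, map_iSup, map_inf]

/-! ### Presentations of lower reals -/

/-- The lower real `x` is the join of the rationals `v i`, the `i`-th of them taken to the extent
`g i`. -/
def Presents {I : Type} (x : nonnegLower.Model A) (g : I → A) (v : I → ℚ≥0) : Prop :=
  ∀ q : ℚ, below x q = ⨆ (i) (_ : q < v i), g i

namespace Presents

variable {I J : Type} {x y : nonnegLower.Model A} {g : I → A} {v : I → ℚ≥0} {g' : J → A}
  {v' : J → ℚ≥0}

/-- Negative rationals lie below every non-negative lower real, so the indices must cover. -/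
theorem iSup_eq_top (h : Presents x g v) : ⨆ i, g i = ⊤ := by
  rw [← top_le_iff, ← (below_spec x).2 (-1) (by norm_num), h]
  exact iSup₂_le fun i _ => le_iSup g i

theorem le_ideal (h : Presents x g v) {i : I} {s : ℚ≥0} (hs : s < v i ∨ s = 0) :
    g i ≤ ideal x s := by
  rcases hs with hs | hs
  · refine le_sup_of_le_left ?_
    rw [h]
    exact le_iSup₂_of_le (f := fun i (_ : (s : ℚ) < v i) => g i) i (by exact_mod_cast hs) le_rfl
  · simp [ideal, hs]

/-- The inequality `s ≤ v i` cannot be made strict: `0` belongs to the ideal even where all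
available `v i` are `0`. -/
theorem ideal_le (h : Presents x g v) (s : ℚ≥0) :
    ideal x s ≤ ⨆ (i) (_ : s ≤ v i), g i := by
  refine sup_le ?_ (iSup_le fun hs => ?_)
  · rw [h]
    refine iSup₂_le fun i hi => ?_
    exact le_iSup₂_of_le (f := fun i (_ : s ≤ v i) => g i) i (by exact_mod_cast hi.le) le_rfl
  · subst hs
    simp [h.iSup_eq_top]

theorem le_of_forall (h : Presents x g v) (h' : Presents y g' v')
    (H : ∀ i, g i ≤ ⨆ (j) (_ : v i ≤ v' j), g' j) (q : ℚ) : below x q ≤ below y q := by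
  rw [h, h']
  refine iSup₂_le fun i hi => (H i).trans (iSup₂_le fun j hj => ?_)
  exact le_iSup₂_of_le (f := fun j (_ : q < v' j) => g' j) j
    (hi.trans_le (by exact_mod_cast hj)) le_rfl

theorem eq_of_forall (h : Presents x g v) (h' : Presents y g' v')
    (H : ∀ i, g i ≤ ⨆ (j) (_ : v i ≤ v' j), g' j)
    (H' : ∀ j, g' j ≤ ⨆ (i) (_ : v' j ≤ v i), g i) : x = y :=
  Model.ext (funext fun q => le_antisymm (h.le_of_forall h' H q) (h'.le_of_forall h H' q))

theorem self (x : nonnegLower.Model A) : Presents x (ideal x) id := by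
  intro q
  refine le_antisymm ?_ (iSup₂_le fun s hs => ?_)
  · rcases lt_or_ge q 0 with hq | hq
    · exact le_iSup₂_of_le (f := fun (s : ℚ≥0) (_ : q < (id s : ℚ≥0)) => ideal x s) 0
        (by simpa using hq) (by simp [ideal])
    · rw [(below_spec x).1]
      refine iSup₂_le fun q' hq' => ?_
      exact le_iSup₂_of_le (f := fun (s : ℚ≥0) (_ : q < (id s : ℚ≥0)) => ideal x s)
        ⟨q', hq.trans hq'.le⟩ hq' le_sup_left
  · refine sup_le (below_anti x hs.le) (iSup_le fun h => ?_)
    subst h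
    rw [(below_spec x).2 q (by simpa using hs)]

theorem ratLower (s : ℚ≥0) : Presents (ratLower A s) (fun _ : Unit => ⊤) fun _ => s := by
  intro q
  simp only [iSup_unique]
  rfl

/-- Multiplication is continuous from below. For `q ≥ 0` both factors are positive, and one picks
`s` between `q / w` and `v`, then `t` between `q / s` and `w`. For negative `q` the exceptional
value `0` serves. -/
theorem exists_lt_mul {v w : ℚ≥0} {q : ℚ} (h : q < v * w) :
    ∃ s t : ℚ≥0, (s < v ∨ s = 0) ∧ (t < w ∨ t = 0) ∧ q < s * t := by
  rcases lt_or_ge q 0 with hq | hq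
  · exact ⟨0, 0, Or.inr rfl, Or.inr rfl, by simpa using hq⟩
  have hv : 0 < v := pos_iff_ne_zero.2 fun h' => by
    simp [h', hq.not_gt] at h
  have hw : 0 < (w : ℚ) := by
    exact_mod_cast pos_iff_ne_zero.2 fun h' => by simp [h', hq.not_gt] at h
  obtain ⟨s, hs, hsv⟩ := exists_between ((div_lt_iff₀ hw).2 h)
  have hs0 : 0 < s := (div_nonneg hq hw.le).trans_lt hs
  rw [div_lt_iff₀ hw, mul_comm, ← div_lt_iff₀ hs0] at hs
  obtain ⟨t, ht, htw⟩ := exists_between hs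
  rw [div_lt_iff₀ hs0, mul_comm] at ht
  exact ⟨⟨s, hs0.le⟩, ⟨t, (div_nonneg hq hs0.le).trans (by
    rw [div_le_iff₀ hs0, mul_comm]
    exact ht.le)⟩, Or.inl hsv, Or.inl htw, ht⟩

/-- Monotonicity of multiplication gives one inequality, its continuity from below (`exists_lt_mul`)
the other. -/
theorem mul (h : Presents x g v) (h' : Presents y g' v') :
    Presents (lowerMul x y) (fun p : I × J => g p.1 ⊓ g' p.2) fun p => v p.1 * v' p.2 := by
  intro q
  refine le_antisymm (iSup₂_le fun p hp => ?_) (iSup₂_le fun p hp => ?_)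
  · refine (inf_le_inf (h.ideal_le p.1) (h'.ideal_le p.2)).trans ?_
    simp only [iSup_inf_eq, inf_iSup_eq]
    -- After distributing, the join for the second factor is outermost: here `i : J` and `j : I`.
    refine iSup₂_le fun i hi => iSup₂_le fun j hj => ?_
    refine le_iSup₂_of_le (f := fun (p : I × J) (_ : q < ((v p.1 * v' p.2 : ℚ≥0) : ℚ)) =>
      g p.1 ⊓ g' p.2) (j, i) (hp.trans_le ?_) le_rfl
    exact_mod_cast mul_le_mul' hj hi
  · obtain ⟨s, t, hs, ht, hq⟩ := exists_lt_mul (by exact_mod_cast hp)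
    exact le_iSup₂_of_le (f := fun (p : ℚ≥0 × ℚ≥0) (_ : q < p.1 * p.2) =>
      ideal x p.1 ⊓ ideal y p.2) (s, t) hq (inf_le_inf (h.le_ideal hs) (h'.le_ideal ht))

theorem exists_lt_pow {v : ℚ≥0} {n : ℕ} {q : ℚ} (h : q < v ^ n) :
    ∃ s : ℚ≥0, (s < v ∨ s = 0) ∧ q < s ^ n := by
  induction n generalizing q with
  -- This uses `0 ^ 0 = 1`.
  | zero => exact ⟨0, Or.inr rfl, by simpa using h⟩
  | succ n ih =>
    rw [pow_succ] at h
    obtain ⟨s, t, hs, ht, hq⟩ := exists_lt_mul (v := v ^ n) (by exact_mod_cast h)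
    rcases hs with hs | hs
    · obtain ⟨s', hs', hq'⟩ := ih (q := s) (by exact_mod_cast hs)
      -- One base must dominate both the `n`-th root approximation `s'` and the last factor `t`.
      refine ⟨max s' t, by grind, hq.trans_le ?_⟩
      rw [pow_succ]
      norm_cast at hq' ⊢
      exact mul_le_mul' (hq'.le.trans (by gcongr; exact le_max_left _ _)) (le_max_right _ _)
    · subst hs
      exact ⟨0, Or.inr rfl, hq.trans_le (by simp)⟩

theorem pow (h : Presents x g v) (a : natural.Model A) :
    Presents (lowerPow x a) (fun p : ℕ × I => isNat a p.1 ⊓ g p.2) fun p => v p.2 ^ p.1 := by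
  intro q
  refine le_antisymm (iSup₂_le fun p hp => ?_) (iSup₂_le fun p hp => ?_)
  · refine (inf_le_inf le_rfl (h.ideal_le p.2)).trans ?_
    simp only [inf_iSup_eq]
    refine iSup₂_le fun i hi => ?_
    refine le_iSup₂_of_le (f := fun (p : ℕ × I) (_ : q < ((v p.2 ^ p.1 : ℚ≥0) : ℚ)) =>
      isNat a p.1 ⊓ g p.2) (p.1, i) (hp.trans_le ?_) le_rfl
    exact_mod_cast pow_le_pow_left' hi p.1
  · obtain ⟨s, hs, hq⟩ := exists_lt_pow (by exact_mod_cast hp)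
    exact le_iSup₂_of_le (f := fun (p : ℕ × ℚ≥0) (_ : q < (p.2 : ℚ) ^ p.1) =>
      isNat a p.1 ⊓ ideal x p.2) (p.1, s) hq (inf_le_inf le_rfl (h.le_ideal hs))

end Presents

/-! ### The Basic Equations for lower reals -/

/-- Stated for any decidability instance, since `nat` is defined with the classical one. -/
theorem isNat_nat (m n : ℕ) [Decidable (m = n)] :
    isNat (nat A n) m = if m = n then ⊤ else ⊥ := by
  rw [isNat, nat]
  dsimp only
  congr

theorem isNat_natOp (f : ℕ → ℕ → ℕ) (a b : natural.Model A) (n : ℕ) :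
    isNat (natOp f a b) n = ⨆ (p : ℕ × ℕ) (_ : f p.1 p.2 = n), isNat a p.1 ⊓ isNat b p.2 :=
  rfl

/-- Directedness of the ideal of `x`. -/
theorem ideal_inf_ideal_le_max (x : nonnegLower.Model A) (s t : ℚ≥0) :
    ideal x s ⊓ ideal x t ≤ ideal x (max s t) := by
  rcases le_total s t with h | h
  · rw [max_eq_right h]
    exact inf_le_right
  · rw [max_eq_left h]
    exact inf_le_left

theorem lowerPow_natAdd (x : nonnegLower.Model A) (a b : natural.Model A) :
    lowerPow x (natAdd a b) = lowerMul (lowerPow x a) (lowerPow x b) := by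
  refine ((Presents.self x).pow _).eq_of_forall
    (((Presents.self x).pow a).mul ((Presents.self x).pow b)) ?_ ?_
  · rintro ⟨k, s⟩
    simp only [natAdd, isNat_natOp, iSup_inf_eq]
    refine iSup₂_le fun p hp => le_iSup₂_of_le ((p.1, s), (p.2, s)) ?_ ?_
    · simp [← hp, pow_add]
    · exact (inf_inf_distrib_right _ _ _).le
  · rintro ⟨⟨n, s⟩, ⟨m, t⟩⟩
    -- The two powers may use different bases; directedness replaces both by the larger one.
    refine le_iSup₂_of_le (n + m, max s t) ?_ ?_
    · simp only [id, pow_add]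
      gcongr
      · exact le_max_left _ _
      · exact le_max_right _ _
    · dsimp only
      rw [inf_inf_inf_comm]
      refine inf_le_inf ?_ (ideal_inf_ideal_le_max x s t)
      exact le_iSup₂_of_le (f := fun (p : ℕ × ℕ) (_ : p.1 + p.2 = n + m) =>
        isNat a p.1 ⊓ isNat b p.2) (n, m) rfl le_rfl

/-- Both sides involve a single base, so directedness is not needed. -/
theorem lowerPow_natMul (x : nonnegLower.Model A) (a b : natural.Model A) :
    lowerPow x (natMul a b) = lowerPow (lowerPow x a) b := by
  refine ((Presents.self x).pow _).eq_of_forall (((Presents.self x).pow a).pow b) ?_ ?_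
  · rintro ⟨k, s⟩
    simp only [natMul, isNat_natOp, iSup_inf_eq]
    refine iSup₂_le fun p hp => le_iSup₂_of_le (p.2, (p.1, s)) ?_ ?_
    · simp [← hp, pow_mul]
    · exact (by rw [inf_comm (isNat a _), inf_assoc])
  · rintro ⟨m, ⟨n, s⟩⟩
    refine le_iSup₂_of_le (n * m, s) ?_ ?_
    · simp [pow_mul]
    · dsimp only
      rw [← inf_assoc, inf_comm (isNat b _)]
      refine inf_le_inf ?_ le_rfl
      exact le_iSup₂_of_le (f := fun (p : ℕ × ℕ) (_ : p.1 * p.2 = n * m) =>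
        isNat a p.1 ⊓ isNat b p.2) (n, m) rfl le_rfl

theorem lowerPow_lowerMul (x y : nonnegLower.Model A) (a : natural.Model A) :
    lowerPow (lowerMul x y) a = lowerMul (lowerPow x a) (lowerPow y a) := by
  refine (((Presents.self x).mul (Presents.self y)).pow a).eq_of_forall
    (((Presents.self x).pow a).mul ((Presents.self y).pow a)) ?_ ?_
  · rintro ⟨n, s, t⟩
    refine le_iSup₂_of_le ((n, s), (n, t)) ?_ ?_
    · simp [mul_pow]
    · exact (inf_inf_distrib_left _ _ _).le
  · rintro ⟨⟨n, s⟩, ⟨m, t⟩⟩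
    dsimp only
    rw [inf_inf_inf_comm]
    -- The two factors may use different exponents, but `a = n` and `a = m` are disjoint unless `n =
    -- m`.
    by_cases hnm : n = m
    · subst hnm
      refine le_iSup₂_of_le (n, (s, t)) ?_ ?_
      · simp [mul_pow]
      · simp
    · simp [(isNat_spec a).2 n m hnm]

/-! ### Standard exponents and rational bases for lower reals -/

theorem Presents.pow_nat {I : Type} {x : nonnegLower.Model A} {g : I → A} {v : I → ℚ≥0}
    (h : Presents x g v) (n : ℕ) : Presents (lowerPow x (nat A n)) g fun i => v i ^ n := by
  intro q
  rw [h.pow]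
  refine le_antisymm (iSup₂_le ?_) (iSup₂_le fun i hi => ?_)
  · rintro ⟨k, i⟩ hi
    dsimp only
    rw [isNat_nat]
    split_ifs with hk
    · subst hk
      exact le_iSup₂_of_le (f := fun i (_ : q < ((v i ^ k : ℚ≥0) : ℚ)) => g i) i hi inf_le_right
    · simp
  · refine le_iSup₂_of_le (n, i) hi ?_
    simp [isNat_nat]

theorem lowerPow_nat_zero (x : nonnegLower.Model A) : lowerPow x (nat A 0) = ratLower A 1 := by
  refine ((Presents.self x).pow_nat 0).eq_of_forall (Presents.ratLower 1) (fun s => ?_)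
    -- The base `0` is always in the ideal and `0 ^ 0 = 1`, so `x ^ 0 = 1` also at `x = 0`.
    fun _ => le_iSup₂_of_le 0 (by simp) (by simp [ideal])
  simp

theorem lowerPow_nat_one (x : nonnegLower.Model A) : lowerPow x (nat A 1) = x := by
  refine Model.ext (funext fun (q : ℚ) => ?_)
  have h := (Presents.self x).pow_nat 1 q
  simp only [pow_one] at h
  exact h.trans (Presents.self x q).symm

theorem lowerPow_ratLower (s : ℚ≥0) (n : ℕ) :
    lowerPow (ratLower A s) (nat A n) = ratLower A (s ^ n) :=
  Model.ext (funext fun (q : ℚ) =>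
    ((Presents.ratLower s).pow_nat n q).trans (Presents.ratLower (s ^ n) q).symm)

theorem lowerPow_one (a : natural.Model A) : lowerPow (ratLower A 1) a = ratLower A 1 := by
  refine ((Presents.ratLower 1).pow a).eq_of_forall (Presents.ratLower 1) (fun p => ?_) fun _ => ?_
  · simp
  · exact (isNat_spec a).1.ge.trans <| iSup_le fun n =>
      le_iSup₂_of_le (n, ()) (by simp) (le_inf le_rfl le_top)

/-! ### Rational powers of upper reals -/

theorem upperPow_ratUpper (s : ℚ≥0) (n : ℕ) :
    upperPow (ratUpper A s) (nat A n) = ratUpper A (s ^ n) := by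
  refine Model.ext (funext fun (r : ℚ) => ?_)
  change (⨆ (p : ℕ × ℚ) (_ : 0 < p.2 ∧ p.2 ^ p.1 < r), isNat (nat A n) p.1 ⊓ ⨆ _ : s < p.2, ⊤) ⊔
      (⨆ (_ : 1 < r), isNat (nat A n) 0) = ⨆ _ : ((s ^ n : ℚ≥0) : ℚ) < r, (⊤ : A)
  refine le_antisymm (sup_le (iSup₂_le ?_) (iSup_le fun hr => ?_)) (iSup_le fun hr => ?_)
  · rintro ⟨k, t⟩ ⟨h0, ht⟩
    dsimp only at *
    rw [isNat_nat]
    split_ifs with hk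
    · subst hk
      rw [top_inf_eq]
      refine iSup_le fun hs => le_iSup_of_le (lt_of_le_of_lt ?_ ht) le_rfl
      push_cast
      gcongr
    · simp
  · rw [isNat_nat]
    split_ifs with hn
    · subst hn
      exact le_iSup_of_le (by simpa using hr) le_rfl
    · simp
  · push_cast at hr
    -- Continuity of the power at `s`, used from the right: `t` must be strictly above `s`, which
    -- also makes it positive.
    have h : ∀ᶠ t in nhdsWithin (s : ℚ) (Set.Ioi s), t ^ n < r :=
      ((continuous_pow n).tendsto (s : ℚ)).eventually_lt_const hr |>.filter_mono nhdsWithin_le_nhds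
    obtain ⟨t, ht, hst⟩ := (h.and self_mem_nhdsWithin).exists
    have hst : (s : ℚ) < t := hst
    refine le_sup_of_le_left (le_iSup₂_of_le (n, t) ⟨s.2.trans_lt hst, ht⟩ ?_)
    simp [isNat_nat, hst]

/-! ### Powers of Dedekind reals -/

/-- The choice of `δ` must be uniform in `s`, because `approx` supplies `s` only once `δ` is fixed.
-/
theorem exists_pow_add_lt (n : ℕ) (b : ℚ) {ε : ℚ} (hε : 0 < ε) :
    ∃ δ : ℚ, 0 < δ ∧ ∀ s, 0 ≤ s → s < b → (s + δ) ^ n < s ^ n + ε := by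
  rcases le_or_gt b 0 with hb | hb
  · exact ⟨1, one_pos, fun s h1 h2 => absurd (h1.trans_lt h2) hb.not_gt⟩
  -- With `δ ≤ 1`, the number `n * (b + 1) ^ (n - 1)` is a Lipschitz constant on the relevant range;
  -- the extra `1` makes the final inequality strict and covers `n = 0`.
  have hC : 0 < n * (b + 1) ^ (n - 1) + 1 := by positivity
  obtain ⟨δ, hδ, hδ1, hδ2⟩ : ∃ δ : ℚ, 0 < δ ∧ δ ≤ 1 ∧ δ * (n * (b + 1) ^ (n - 1) + 1) ≤ ε :=
    ⟨min 1 (ε / (n * (b + 1) ^ (n - 1) + 1)), lt_min one_pos (div_pos hε hC), min_le_left _ _,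
      (le_div_iff₀ hC).1 (min_le_right _ _)⟩
  refine ⟨δ, hδ, fun s h1 h2 => ?_⟩
  have h3 := (le_abs_self _).trans (abs_pow_sub_pow_le (s + δ) s n)
  rw [add_sub_cancel_left, abs_of_pos hδ, abs_of_nonneg h1, abs_of_nonneg (by positivity),
    max_eq_left (by linarith)] at h3
  have h4 : δ * n * (s + δ) ^ (n - 1) ≤ δ * n * (b + 1) ^ (n - 1) := by
    gcongr
  linarith

/-- Powers of non-negative Dedekind reals. -/
def dedekindPow (x : nonnegDedekind.Model A) (a : natural.Model A) : nonnegDedekind.Model A :=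
  ofSections (lowerPow (leftSection x) a) (upperPow (rightSection x) a)
    (by
      have h : (⨆ n, isNat a n) ⊓ (⨆ r, above (rightSection x) r) = ⊤ := by
        rw [(sections_spec x).1, (isNat_spec a).1, inf_top_eq]
      rw [← top_le_iff, ← h, iSup_inf_iSup]
      refine iSup_le fun ⟨n, r⟩ => ?_
      dsimp only
      rcases le_or_gt r 0 with hr | hr
      · simp [above_nonpos _ hr]
      · refine le_iSup_of_le (r ^ n + 1) (le_trans ?_ le_sup_left)
        exact le_iSup₂_of_le (f := fun (p : ℕ × ℚ) (_ : 0 < p.2 ∧ p.2 ^ p.1 < r ^ n + 1) =>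
          isNat a p.1 ⊓ above (rightSection x) p.2) (n, r) ⟨hr, lt_add_one _⟩ le_rfl)
    (fun q r hqr => by
      rw [← le_bot_iff]
      simp only [below, above, lowerPow, upperPow, iSup_inf_eq, inf_iSup_eq, inf_sup_left]
      -- The second case is the additional disjunct of `upperPow`, where `a = 0` and `1 < r`.
      refine sup_le (iSup₂_le fun p hp => iSup₂_le fun p' hp' => ?_)
        (iSup_le fun hr => iSup₂_le fun p hp => ?_)
      · obtain ⟨n, t⟩ := p
        obtain ⟨m, s⟩ := p'
        dsimp only at *
        rw [inf_inf_inf_comm]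
        by_cases hnm : m = n
        · subst hnm
          have hst : ¬ (s : ℚ) < t := fun hst =>
            hqr (hp'.trans ((pow_le_pow_left₀ s.2 hst.le m).trans_lt hp.2))
          exact inf_le_right.trans (ideal_inf_above x s t hst).le
        · simp [(isNat_spec a).2 m n hnm]
      · by_cases hn : p.1 = 0
        · rw [hn, pow_zero] at hp
          exact absurd (hp.trans hr) hqr
        · rw [← (isNat_spec a).2 _ 0 hn]
          exact inf_le_inf_right _ inf_le_left)
    (fun q r hqr => by
      have h : (⨆ n, isNat a n) ⊓ (⨆ b, above (rightSection x) b) = ⊤ := by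
        rw [(sections_spec x).1, (isNat_spec a).1, inf_top_eq]
      rw [← top_le_iff, ← h, iSup_inf_iSup]
      refine iSup_le fun ⟨n, b⟩ => ?_
      -- Where `a = n` and `x < b`, this `δ` makes the gap between `s ^ n` and `(s + δ) ^ n` smaller
      -- than `r - q`, so either `q < s ^ n` or `(s + δ) ^ n < r`.
      obtain ⟨δ, hδ, hδ'⟩ := exists_pow_add_lt n b (sub_pos.2 hqr)
      dsimp only
      rw [← inf_top_eq (isNat a n ⊓ _), ← approx x δ hδ, inf_iSup_eq]
      refine iSup_le fun s => ?_
      by_cases hs : (s : ℚ) < b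
      swap
      · refine le_trans ?_ bot_le
        rw [← ideal_inf_above x s b hs]
        exact le_inf (inf_le_right.trans inf_le_left) (inf_le_left.trans inf_le_right)
      by_cases hq : q < (s : ℚ) ^ n
      · refine le_trans ?_ le_sup_left
        exact le_iSup₂_of_le (f := fun (p : ℕ × ℚ≥0) (_ : q < (p.2 : ℚ) ^ p.1) =>
          isNat a p.1 ⊓ ideal (leftSection x) p.2) (n, s) hq (inf_le_inf inf_le_left inf_le_left)
      · refine le_trans ?_ (le_sup_left.trans le_sup_right)
        refine le_iSup₂_of_le (f := fun (p : ℕ × ℚ) (_ : 0 < p.2 ∧ p.2 ^ p.1 < r) =>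
          isNat a p.1 ⊓ above (rightSection x) p.2) (n, s + δ)
          ⟨add_pos_of_nonneg_of_pos s.2 hδ, ?_⟩ (inf_le_inf inf_le_left inf_le_right)
        have := hδ' s s.2 hs
        dsimp only
        linarith)

theorem dedekindPow_map (h : FrameHom A B) (x : nonnegDedekind.Model A) (a : natural.Model A) :
    (dedekindPow x a).map h = dedekindPow (x.map h) (a.map h) := by
  refine Model.ext (funext fun c => ?_)
  rcases c with q | r
  · exact congrFun (congrArg Model.val (lowerPow_map h (leftSection x) a)) q
  · exact congrFun (congrArg Model.val (upperPow_map h (rightSection x) a)) r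

/-- If `y < r` then `y < r'` for some `r' < r`. Locatedness of `x` gives `r' < x` or `x < r`, and
the former would imply `r' < y`. -/
theorem above_le_of_below_le {x y : nonnegDedekind.Model A}
    (h : ∀ q, below (leftSection x) q ≤ below (leftSection y) q) (r : ℚ) :
    above (rightSection y) r ≤ above (rightSection x) r := by
  rw [(above_spec _).1 r]
  refine iSup₂_le fun r' hr => ?_
  rw [← inf_top_eq (above _ r'), ← (sections_spec x).2.2 r' r hr, inf_sup_left]
  refine sup_le (le_trans ?_ bot_le) inf_le_right
  rw [← (sections_spec y).2.1 r' r' (lt_irrefl _), inf_comm]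
  exact inf_le_inf_right _ (h r')

/-- A Dedekind real is determined by its left section. -/
theorem leftSection_injective :
    Function.Injective (leftSection : nonnegDedekind.Model A → nonnegLower.Model A) := by
  intro x y h
  refine Model.ext (funext fun c => ?_)
  rcases c with q | r
  · exact congrFun (congrArg Model.val h) q
  · exact le_antisymm (above_le_of_below_le (fun q => by rw [h]) r)
      (above_le_of_below_le (fun q => by rw [h]) r)

end PointFree

/-! ### The maps of spaces and the Basic Equations -/

open PointFree in
theorem mainTheorem10 :
    -- the powers of one-sided reals are maps of spaces that extend the powers of rationals
    (∃ powL : (nonnegLower.prod natural).space ⟶ nonnegLower.space,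
      ∀ (A : Type u) [Order.Frame A],
        (∀ (x : nonnegLower.Model A) (a : natural.Model A), apply₂ powL x a = lowerPow x a) ∧
        ∀ (s : ℚ≥0) (n : ℕ), lowerPow (ratLower A s) (nat A n) = ratLower A (s ^ n)) ∧
    (∃ powR : (nonnegUpper.prod natural).space ⟶ nonnegUpper.space,
      ∀ (A : Type u) [Order.Frame A],
        (∀ (x : nonnegUpper.Model A) (a : natural.Model A), apply₂ powR x a = upperPow x a) ∧
        ∀ (s : ℚ≥0) (n : ℕ), upperPow (ratUpper A s) (nat A n) = ratUpper A (s ^ n)) ∧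
    -- they combine to a map of spaces on the non-negative Dedekind reals
    ∃ pow : (nonnegDedekind.prod natural).space ⟶ nonnegDedekind.space,
      ∀ (A : Type u) [Order.Frame A],
        (∀ (x : nonnegDedekind.Model A) (a : natural.Model A),
          leftSection (apply₂ pow x a) = lowerPow (leftSection x) a ∧
          rightSection (apply₂ pow x a) = upperPow (rightSection x) a) ∧
        -- the Basic Equations
        (∀ (x : nonnegDedekind.Model A) (a b : natural.Model A),
          apply₂ pow x (natAdd a b) = mul (apply₂ pow x a) (apply₂ pow x b)) ∧
        (∀ x : nonnegDedekind.Model A, apply₂ pow x (nat A 0) = ratDedekind A 1) ∧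
        (∀ (x : nonnegDedekind.Model A) (a b : natural.Model A),
          apply₂ pow x (natMul a b) = apply₂ pow (apply₂ pow x a) b) ∧
        (∀ x : nonnegDedekind.Model A, apply₂ pow x (nat A 1) = x) ∧
        (∀ (x y : nonnegDedekind.Model A) (a : natural.Model A),
          apply₂ pow (mul x y) a = mul (apply₂ pow x a) (apply₂ pow y a)) ∧
        (∀ a : natural.Model A, apply₂ pow (ratDedekind A 1) a = ratDedekind A 1) := by
  refine ⟨?_, ?_, ?_⟩
  · obtain ⟨f, hf⟩ := PropTheory.exists_apply₂_eq (fun {C} _ => lowerPow (A := C)) lowerPow lowerPow_map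
    exact ⟨f, fun A _ => ⟨hf A, lowerPow_ratLower⟩⟩
  · obtain ⟨f, hf⟩ := PropTheory.exists_apply₂_eq (fun {C} _ => upperPow (A := C)) upperPow upperPow_map
    exact ⟨f, fun A _ => ⟨hf A, upperPow_ratUpper⟩⟩
  · obtain ⟨f, hf⟩ :=
      PropTheory.exists_apply₂_eq (fun {C} _ => dedekindPow (A := C)) dedekindPow dedekindPow_map
    refine ⟨f, fun A _ => ?_⟩
    have hf' := hf A
    simp only [hf']
    -- The left sections of `mul`, `dedekindPow` and `ratDedekind` are by definition `lowerMul`,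
    -- `lowerPow` and `ratLower`, so the equations for lower reals apply as they stand.
    exact ⟨fun x a => ⟨rfl, rfl⟩,
      fun x a b => leftSection_injective (lowerPow_natAdd _ a b),
      fun x => leftSection_injective (lowerPow_nat_zero _),
      fun x a b => leftSection_injective (lowerPow_natMul _ a b),
      fun x => leftSection_injective (lowerPow_nat_one _),
      fun x y a => leftSection_injective (lowerPow_lowerMul _ _ a),
      fun a => leftSection_injective (lowerPow_one a)⟩
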